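/- Let $(\Sigma,\Lambda)$ be a discrete Riemann surface: $\Sigma$ is a compact connected oriented polyhedral surface without boundary, and $\Lambda$ is a decomposition of $\Sigma$ into finitely many flat quadrilaterals, glued isometrically along their sides, such that all conical singularities are vertices and the graph of vertices and edges of $\Lambda$ is bipartite, with black and white vertices. For a face $Q$ with vertices $b_-,w_-,b_+,w_+$ in counterclockwise order, $b_\pm$ black and $w_\pm$ white, placed isometrically in $\mathbb C$ by a chart $z_Q$, let $\rho_Q=-i\,\frac{w_+-w_-}{b_+-b_-}$. The medial graph $X$ has the midpoints of the edges of $\Lambda$ as vertices, and an edge $[Q,v]$ for each face $Q$ and each corner $v$ of $Q$, which joins the midpoints of the two sides of $Q$ at $v$; it is parallel to the black diagonal of $Q$ if $v$ is white and to the white diagonal if $v$ is black. The faces of $X$ correspond to the faces and to the vertices of $\Lambda$. A discrete differential is a function $\omega$ on the oriented edges of $X$ with $\omega(-e)=-\omega(e)$ and values in $\mathbb C$. It is of type $\Diamond$ if, inside each $Q$, it takes the same value on parallel edges with the same direction. It is closed if $\oint_{\partial F}\omega=0$ for all faces $F$ of $X$. It is discrete holomorphic if it is closed, of type $\Diamond$,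 and of the form $p_Q\,dz_Q$ with some $p_Q\in\mathbb C$ in each face $Q$. Let $a_1,\dots,a_g,b_1,\dots,b_g$ be a canonical basis of $H_1(\Sigma,\mathbb Z)$, that is, a basis with intersection numbers $a_j\cdot b_k=\delta_{jk}$ and $a_j\cdot a_k=b_j\cdot b_k=0$, represented by closed paths on $X$ with a common base point. For a closed path $P$ on $X$, the black period $2\int_{BP}\omega$ and the white period $2\int_{WP}\omega$ of $\omega$ are twice the sums of $\omega$ over those oriented edges of $P$ that are parallel to black, respectively white, diagonals. Let $\omega^B_k$ be the unique discrete holomorphic differential with black $a_j$-periods $\delta_{jk}$ and vanishing white $a$-periods, let $\omega^W_k$ be the unique one with white $a_j$-periods $\delta_{jk}$ and vanishing black $a$-periods, and let \[\Pi^{B,B}_{jk}=2\int_{Bb_j}\omega^B_k,\quad \Pi^{W,B}_{jk}=2\int_{Wb_j}\omega^B_k,\quad \Pi^{B,W}_{jk}=2\int_{Bb_j}\omega^W_k,\quad \Pi^{W,W}_{jk}=2\int_{Wb_j}\omega^W_k .\] **Lemma.** If all quadrilaterals are orthodiagonal, that is, $\rho_Q\in\mathbb R$ for all faces $Q$, then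 the differentials $\omega^B_k$ and $\omega^W_k$ exist and are unique, the $g\times g$ matrices $\Pi^{W,B}$ and $\Pi^{B,W}$ are purely imaginary, and $\Pi^{B,B}$ and $\Pi^{W,W}$ are real. -/

import Mathlib

open scoped BigOperators

/-- The four points `z 0, z 1, z 2, z 3` are, in this order, the vertices of a positively oriented
(not necessarily convex) simple quadrilateral of the complex plane: its sides meet only in common
endpoints, and its signed area is positive (the displayed quantity is twice the signed area). -/
def IsEmbeddedQuad (z : Fin 4 → ℂ) : Prop :=
  0 < ((starRingEnd ℂ) (z 2 - z 0) * (z 3 - z 1)).im ∧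
  (∀ i : Fin 4, segment ℝ (z i) (z (i + 1)) ∩ segment ℝ (z (i + 1)) (z (i + 2)) = {z (i + 1)}) ∧
  (∀ i : Fin 4, Disjoint (segment ℝ (z i) (z (i + 1))) (segment ℝ (z (i + 2)) (z (i + 3))))

/-- A discrete Riemann surface `(Σ, Λ)` with set of faces `F`: a compact connected oriented
polyhedral surface without boundary, obtained by gluing finitely many flat quadrilaterals along
their sides, such that the resulting quad-graph is bipartite.

The vertices of the face `Q` in counterclockwise order are `b₋, w₋, b₊, w₊`; they are the corners
`(Q, 0), (Q, 1), (Q, 2), (Q, 3)`, so that the black corners are the even ones.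
The pair `(Q, i)` also denotes the side of `Q` that runs from corner `i` to corner `i + 1`. -/
structure DiscreteRiemannSurface (F : Type*) [Fintype F] where
  /-- There is at least one face. -/
  nonempty : Nonempty F
  /-- A discrete chart of each face. -/
  z : F → Fin 4 → ℂ
  /-- Each face is a flat embedded quadrilateral, the chart preserves the orientation. -/
  embedded : ∀ Q, IsEmbeddedQuad (z Q)
  /-- The side that is glued to a given side. If `(Q', j) = glue (Q, i)`, the two sides are
  identified with opposite directions: corner `i` of `Q` with corner `j + 1` of `Q'`, and corner
  `i + 1` of `Q` with corner `j` of `Q'`. -/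
  glue : Equiv.Perm (F × Fin 4)
  /-- The sides are glued in pairs. -/
  glue_glue : ∀ s, glue (glue s) = s
  /-- Black corners are glued to black corners, and white corners to white corners
  (in particular, no side is glued to itself). -/
  bipartite : ∀ s, (Even ((glue s).2 : ℕ) ↔ ¬ Even (s.2 : ℕ))
  /-- Sides that are glued have the same length. -/
  isometric : ∀ s, ‖z (glue s).1 ((glue s).2 + 1) - z (glue s).1 (glue s).2‖ =
    ‖z s.1 (s.2 + 1) - z s.1 s.2‖
  /-- The surface is connected. -/
  connected : ∀ Q Q' : F,
    Relation.ReflTransGen (fun R R' : F => ∃ i : Fin 4, (glue (R, i)).1 = R') Q Q'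

namespace DiscreteRiemannSurface

variable {F : Type*} [Fintype F] (S : DiscreteRiemannSurface F)

/-! ### The discrete complex structure -/

/-- `ρ_Q = -i (w₊ - w₋) / (b₊ - b₋)`. -/
noncomputable def rho (Q : F) : ℂ :=
  -Complex.I * ((S.z Q 3 - S.z Q 1) / (S.z Q 2 - S.z Q 0))

/-- All quadrilaterals are orthodiagonal: all `ρ_Q` are real. -/
def Orthodiagonal : Prop := ∀ Q, (S.rho Q).im = 0

/-! ### Vertices of the quad-graph and the medial graph -/

/-- Going once around a vertex from quadrilateral to quadrilateral: the side `(Q, i - 1)` ends at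
the corner `(Q, i)`, which is identified with the first corner of the glued side. -/
def rot : Equiv.Perm (F × Fin 4) :=
  ((Equiv.refl F).prodCongr (Equiv.subRight (1 : Fin 4))).trans S.glue

/-- The vertices of `Λ`: classes of corners that are identified by the gluing. -/
def Vertex : Type _ := Quotient (Equiv.Perm.SameCycle.setoid S.rot)

/-- The vertex of `Λ` at a corner. -/
def vertex (c : F × Fin 4) : S.Vertex := Quotient.mk (Equiv.Perm.SameCycle.setoid S.rot) c

/-- The vertices of the medial graph `X`: the (midpoints of the) edges of `Λ`, which are classes
of glued sides. -/
def MedialVertex : Type _ := Quotient (Equiv.Perm.SameCycle.setoid S.glue)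

/-- The midpoint of a side. -/
def mid (s : F × Fin 4) : S.MedialVertex := Quotient.mk (Equiv.Perm.SameCycle.setoid S.glue) s

/-- Oriented edges of the medial graph. The edge `[Q, v]`, with `v` the vertex at the corner
`(Q, i)`, joins the midpoints of the sides `i - 1` and `i` of `Q`; the pair `((Q, i), true)` is
this edge oriented from side `i - 1` to side `i`, and `((Q, i), false)` is the opposite one. -/
abbrev MedialDart (_S : DiscreteRiemannSurface F) : Type _ := (F × Fin 4) × Bool

/-- Initial vertex of an oriented medial edge. -/
def src (e : S.MedialDart) : S.MedialVertex :=
  if e.2 then S.mid (e.1.1, e.1.2 - 1) else S.mid e.1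

/-- Terminal vertex of an oriented medial edge. -/
def tgt (e : S.MedialDart) : S.MedialVertex :=
  if e.2 then S.mid e.1 else S.mid (e.1.1, e.1.2 - 1)

/-- `S.IsPath x P y`: the list `P` of oriented medial edges is a path from `x` to `y` on `X`. -/
def IsPath : S.MedialVertex → List S.MedialDart → S.MedialVertex → Prop
  | x, [], y => x = y
  | x, e :: P, y => S.src e = x ∧ IsPath (S.tgt e) P y

/-- Closed paths on the medial graph with base point `x`. -/
def Loop (x : S.MedialVertex) : Type _ := {P : List S.MedialDart // S.IsPath x P x}

/-! ### Discrete differentials -/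

/-- A discrete differential, a function `ω` on the oriented edges of `X` with `ω(-e) = -ω(e)`, is
given by its values on the edges `[Q, v]` in the orientation of `((Q, i), true)`. -/
abbrev Differential (_S : DiscreteRiemannSurface F) : Type _ := F × Fin 4 → ℂ

/-- The value of a discrete differential on an oriented medial edge. -/
def value (ω : S.Differential) (e : S.MedialDart) : ℂ := if e.2 then ω e.1 else -ω e.1

/-- `∫_P ω` for a list `P` of oriented medial edges. -/
def integral (ω : S.Differential) (P : List S.MedialDart) : ℂ := (P.map (S.value ω)).sum

/-- A discrete differential is of type `◇` if it has the same values on parallel oriented edges in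
each quadrilateral. The edges at opposite corners are parallel, and their orientations as
`((Q, i), true)` and `((Q, i + 2), true)` are opposite. -/
def IsTypeDiamond (ω : S.Differential) : Prop :=
  ∀ (Q : F) (i : Fin 4), ω (Q, i + 2) = -ω (Q, i)

open scoped Classical in
/-- `dω = 0`: the integral of `ω` along the boundary of each face of the medial graph vanishes,
both for the face inside a quadrilateral `Q` and for the face around a vertex `v`. -/
def IsClosed (ω : S.Differential) : Prop :=
  (∀ Q : F, ∑ i : Fin 4, ω (Q, i) = 0) ∧
  (∀ v : S.Vertex, ∑ c : F × Fin 4, (if S.vertex c = v then ω c else 0) = 0)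

/-- The discrete differential `dz` in the discrete charts of the quadrilaterals: its value on the
oriented edge from the midpoint of side `i - 1` to the midpoint of side `i`. -/
noncomputable def dz (c : F × Fin 4) : ℂ :=
  (S.z c.1 c.2 + S.z c.1 (c.2 + 1)) / 2 - (S.z c.1 (c.2 - 1) + S.z c.1 c.2) / 2

/-- Discrete holomorphic differentials: closed discrete differentials of type `◇` that have the
form `p dz` in a discrete chart of each quadrilateral. -/
def IsHolomorphic (ω : S.Differential) : Prop :=
  S.IsTypeDiamond ω ∧ S.IsClosed ω ∧ ∀ Q : F, ∃ p : ℂ, ∀ i : Fin 4, ω (Q, i) = p * S.dz (Q, i)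

/-! ### Black and white periods -/

/-- The oriented edges of `P` that are parallel to black diagonals, which are those at white
corners. -/
def blackPart (P : List S.MedialDart) : List S.MedialDart :=
  P.filter fun e => decide (¬ Even (e.1.2 : ℕ))

/-- The oriented edges of `P` that are parallel to white diagonals, which are those at black
corners. -/
def whitePart (P : List S.MedialDart) : List S.MedialDart :=
  P.filter fun e => decide (Even (e.1.2 : ℕ))

/-- The black period of `ω` along `P`. -/
noncomputable def blackPeriod (ω : S.Differential) (P : List S.MedialDart) : ℂ :=
  2 * S.integral ω (S.blackPart P)

/-- The white period of `ω` along `P`. -/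
noncomputable def whitePeriod (ω : S.Differential) (P : List S.MedialDart) : ℂ :=
  2 * S.integral ω (S.whitePart P)

/-! ### Homology -/

open scoped Classical in
/-- The cellular boundary map `C₁(X; ℤ) → C₀(X; ℤ)` of the medial decomposition. -/
noncomputable def boundaryOne : (F × Fin 4 → ℤ) →ₗ[ℤ] (S.MedialVertex → ℤ) :=
  ∑ c : F × Fin 4, (LinearMap.proj c).smulRight
    ((Pi.single (S.tgt (c, true)) 1 - Pi.single (S.src (c, true)) 1 : S.MedialVertex → ℤ))

/-- The cellular boundary map `C₂(X; ℤ) → C₁(X; ℤ)` of the medial decomposition, whose faces are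
the quadrilaterals and the vertices of `Λ`, with counterclockwise boundaries. The edge
`((Q, i), true)` runs counterclockwise around `Q` and clockwise around the vertex at `(Q, i)`. -/
def boundaryTwo : ((F → ℤ) × (S.Vertex → ℤ)) →ₗ[ℤ] (F × Fin 4 → ℤ) where
  toFun m c := m.1 c.1 - m.2 (S.vertex c)
  map_add' m n := by
    funext c
    simp only [Prod.fst_add, Prod.snd_add, Pi.add_apply]
    ring
  map_smul' r m := by
    funext c
    simp only [Prod.smul_fst, Prod.smul_snd, Pi.smul_apply, smul_eq_mul, RingHom.id_apply]
    ring

/-- `H₁(Σ, ℤ)`, as cellular homology of the medial decomposition. -/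
abbrev H1 : Type _ :=
  (LinearMap.ker S.boundaryOne) ⧸
    ((LinearMap.range S.boundaryTwo).submoduleOf (LinearMap.ker S.boundaryOne))

open scoped Classical in
/-- The 1-chain of an oriented medial edge. -/
noncomputable def dartChain (e : S.MedialDart) : F × Fin 4 → ℤ :=
  if e.2 then Pi.single e.1 1 else -Pi.single e.1 1

/-- The 1-chain of a list of oriented medial edges. -/
noncomputable def chain (P : List S.MedialDart) : F × Fin 4 → ℤ := (P.map S.dartChain).sum

open scoped Classical in
theorem boundaryOne_single (c : F × Fin 4) :
    S.boundaryOne (Pi.single c 1) =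
      Pi.single (S.tgt (c, true)) 1 - Pi.single (S.src (c, true)) 1 := by
  simp only [boundaryOne, LinearMap.sum_apply, LinearMap.smulRight_apply, LinearMap.proj_apply]
  rw [Finset.sum_eq_single c]
  · simp
  · intro b _ hb
    simp [Pi.single_eq_of_ne hb]
  · intro h
    exact absurd (Finset.mem_univ c) h

open scoped Classical in
theorem boundaryOne_dartChain (e : S.MedialDart) :
    S.boundaryOne (S.dartChain e) = Pi.single (S.tgt e) 1 - Pi.single (S.src e) 1 := by
  obtain ⟨c, s⟩ := e
  cases s
  · simp only [dartChain, Bool.false_eq_true, if_false, map_neg, boundaryOne_single, neg_sub]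
    simp [src, tgt]
  · simp only [dartChain, if_true, boundaryOne_single]

open scoped Classical in
theorem boundaryOne_chain {x y : S.MedialVertex} (P : List S.MedialDart) (h : S.IsPath x P y) :
    S.boundaryOne (S.chain P) = Pi.single y 1 - Pi.single x 1 := by
  induction P generalizing x with
  | nil =>
    have hxy : x = y := h
    simp [chain, hxy]
  | cons e P ih =>
    obtain ⟨h1, h2⟩ := h
    have hc : S.chain (e :: P) = S.dartChain e + S.chain P := by simp [chain]
    rw [hc, map_add, ih h2, boundaryOne_dartChain, h1]
    abel

theorem chain_mem_ker {x : S.MedialVertex} (P : S.Loop x) :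
    S.chain P.1 ∈ LinearMap.ker S.boundaryOne := by
  classical
  rw [LinearMap.mem_ker, S.boundaryOne_chain P.1 P.2, sub_self]

/-- The class in `H₁(Σ, ℤ)` of a closed path on the medial graph. -/
noncomputable def homologyClass {x : S.MedialVertex} (P : S.Loop x) : S.H1 :=
  Submodule.Quotient.mk ⟨S.chain P.1, S.chain_mem_ker P⟩

/-- How often (with signs) the path `B(P)` on the black graph, which is induced by the path `P` on
`X`, runs through the diagonal of `Q` from `b₋` to `b₊`. -/
noncomputable def blackCount (P : List S.MedialDart) (Q : F) : ℤ :=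
  S.chain P (Q, 1) - S.chain P (Q, 3)

/-- How often (with signs) the path `W(P)` on the white graph, which is induced by the path `P` on
`X`, runs through the diagonal of `Q` from `w₋` to `w₊`. -/
noncomputable def whiteCount (P : List S.MedialDart) (Q : F) : ℤ :=
  S.chain P (Q, 2) - S.chain P (Q, 0)

/-- The algebraic intersection number of two closed paths `P`, `P'` on `X`. They are homotopic to
`B(P)` and to `W(P')`, and these cross only where both diagonals of a quadrilateral are used; the
diagonal from `w₋` to `w₊` crosses the one from `b₋` to `b₊` from right to left, which is a
crossing of sign `+1`. -/
noncomputable def intersection (P P' : List S.MedialDart) : ℤ :=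
  ∑ Q : F, S.blackCount P Q * S.whiteCount P' Q

/-- A canonical homology basis `a₁, …, a_g, b₁, …, b_g` of `H₁(Σ, ℤ)`, represented by closed paths
on the medial graph with a common base point. The path `cycle (Sum.inl k)` represents `a_k`, and
`cycle (Sum.inr k)` represents `b_k`. -/
structure CanonicalHomologyBasis (g : ℕ) where
  /-- The common base point. -/
  base : S.MedialVertex
  /-- The closed paths. -/
  cycle : Fin g ⊕ Fin g → S.Loop base
  /-- Their classes are linearly independent. -/
  linearIndependent : LinearIndependent ℤ fun k => S.homologyClass (cycle k)
  /-- Their classes generate the homology group. -/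
  span_eq_top : Submodule.span ℤ (Set.range fun k => S.homologyClass (cycle k)) = ⊤
  /-- `a_j · a_k = b_j · b_k = 0` and `a_j · b_k = δ_jk = - b_j · a_k`. -/
  intersection_eq :
    (Matrix.of fun k l => S.intersection (cycle k).1 (cycle l).1) = Matrix.fromBlocks 0 1 (-1) 0

variable {S} {g : ℕ} (H : S.CanonicalHomologyBasis g)

/-- The closed path on `X` that represents `a_k`. -/
def CanonicalHomologyBasis.a (k : Fin g) : List S.MedialDart := (H.cycle (Sum.inl k)).1

/-- The closed path on `X` that represents `b_k`. -/
def CanonicalHomologyBasis.b (k : Fin g) : List S.MedialDart := (H.cycle (Sum.inr k)).1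

/-! ### The canonical basis of discrete holomorphic differentials and the period matrices -/

/-- The conditions that characterize `ω_k^B`: it is discrete holomorphic, its black `a_j`-period is
`δ_jk`, and its white `a`-periods vanish. -/
def IsOmegaB (k : Fin g) (ω : S.Differential) : Prop :=
  S.IsHolomorphic ω ∧ ∀ j : Fin g,
    S.blackPeriod ω (H.a j) = (if j = k then 1 else 0) ∧ S.whitePeriod ω (H.a j) = 0

/-- The conditions that characterize `ω_k^W`: it is discrete holomorphic, its white `a_j`-period is
`δ_jk`, and its black `a`-periods vanish. -/
def IsOmegaW (k : Fin g) (ω : S.Differential) : Prop :=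
  S.IsHolomorphic ω ∧ ∀ j : Fin g,
    S.whitePeriod ω (H.a j) = (if j = k then 1 else 0) ∧ S.blackPeriod ω (H.a j) = 0

/-- The differential `ω_k^B`. -/
noncomputable def omegaB (k : Fin g) : S.Differential := Classical.epsilon (IsOmegaB H k)

/-- The differential `ω_k^W`. -/
noncomputable def omegaW (k : Fin g) : S.Differential := Classical.epsilon (IsOmegaW H k)

/-- `Π^{B,B}`: the black `b`-periods of the `ω_k^B`. -/
noncomputable def PiBB : Matrix (Fin g) (Fin g) ℂ :=
  Matrix.of fun j k => S.blackPeriod (omegaB H k) (H.b j)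

/-- `Π^{W,B}`: the white `b`-periods of the `ω_k^B`. -/
noncomputable def PiWB : Matrix (Fin g) (Fin g) ℂ :=
  Matrix.of fun j k => S.whitePeriod (omegaB H k) (H.b j)

/-- `Π^{B,W}`: the black `b`-periods of the `ω_k^W`. -/
noncomputable def PiBW : Matrix (Fin g) (Fin g) ℂ :=
  Matrix.of fun j k => S.blackPeriod (omegaW H k) (H.b j)

/-- `Π^{W,W}`: the white `b`-periods of the `ω_k^W`. -/
noncomputable def PiWW : Matrix (Fin g) (Fin g) ℂ :=
  Matrix.of fun j k => S.whitePeriod (omegaW H k) (H.b j)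

end DiscreteRiemannSurface

/-! Let `r = Re ρ`, which is positive because the faces are positively oriented. When `ρ` is real, a
discrete holomorphic differential is determined by its value `p` on half of each black diagonal, its
value on the white half-diagonals being `i r p`. Closedness separates into black and white
conditions with real coefficients, so it holds exactly when `Re p` and `Im p` are both real harmonic
forms: `B` is closed on the black graph and `r B` on the white graph (`isClosed_ofForm_iff`,
`Orthodiagonal.isHolomorphic_iff`).

A harmonic form is determined by the black `a`-periods of `B` and the white `a`-periods of `r B`: if
these vanish, the Riemann bilinear identity `CanonicalHomologyBasis.sum_mul_eq` gives `∑ r B² = 0`.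
Conversely, Poincaré duals of cycles and the Hodge decomposition produce harmonic forms with
arbitrary black periods, so the dimension is at least `2g`. Hence the `a`-period map is bijective
(`aPeriods_bijective`).

It follows that the differential with prescribed black `a`-periods has real `p`, and the one with
prescribed white `a`-periods has imaginary `p` (`isOmegaB_iff`, `isOmegaW_iff`). For real `p` all
black periods are real and all white ones imaginary; for imaginary `p` it is the other way round. -/

theorem Equiv.Perm.SameCycle.apply_eq_of_invariant {α β : Type*} {σ : Equiv.Perm α} {f : α → β}
    (hf : ∀ x, f (σ x) = f x) {x y : α} (h : σ.SameCycle x y) : f x = f y := by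
  have hinv : ∀ x, f (σ⁻¹ x) = f x := fun x => by simpa using (hf (σ⁻¹ x)).symm
  obtain ⟨n, rfl⟩ := h
  induction n with
  | zero => simp
  | succ n ih => rw [add_comm, zpow_add, zpow_one, Equiv.Perm.mul_apply, hf, ← ih]
  | pred n ih =>
    rw [sub_eq_add_neg, add_comm, zpow_add, zpow_neg_one, Equiv.Perm.mul_apply, hinv, ← ih]

/-! ### Black and white chains; functions on vertices and on edges of `Λ` -/

namespace DiscreteRiemannSurface

/-- The black 1-chain induced by a medial 1-chain. -/
def blackChain {E : Type*} : (E × Fin 4 → ℤ) →ₗ[ℤ] (E → ℤ) where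
  toFun c Q := c (Q, 1) - c (Q, 3)
  map_add' c d := by
    funext Q
    simp only [Pi.add_apply]
    ring
  map_smul' r c := by
    funext Q
    simp only [Pi.smul_apply, smul_eq_mul, RingHom.id_apply]
    ring

/-- The white 1-chain induced by a medial 1-chain. -/
def whiteChain {E : Type*} : (E × Fin 4 → ℤ) →ₗ[ℤ] (E → ℤ) where
  toFun c Q := c (Q, 2) - c (Q, 0)
  map_add' c d := by
    funext Q
    simp only [Pi.add_apply]
    ring
  map_smul' r c := by
    funext Q
    simp only [Pi.smul_apply, smul_eq_mul, RingHom.id_apply]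
    ring

theorem blackChain_apply {E : Type*} (c : E × Fin 4 → ℤ) (Q : E) :
    blackChain c Q = c (Q, 1) - c (Q, 3) := rfl

theorem whiteChain_apply {E : Type*} (c : E × Fin 4 → ℤ) (Q : E) :
    whiteChain c Q = c (Q, 2) - c (Q, 0) := rfl

variable {F : Type*} [Fintype F] (S : DiscreteRiemannSurface F)

noncomputable instance : Fintype S.Vertex := by
  classical
  exact Quotient.fintype _

noncomputable instance : Fintype S.MedialVertex := by
  classical
  exact Quotient.fintype _

/-- The function on the vertices of `Λ` induced by a function on corners. -/
def liftVertex {β : Type*} (f : F × Fin 4 → β) (hf : ∀ c, f (S.rot c) = f c) : S.Vertex → β :=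
  Quotient.lift f fun _ _ h => Equiv.Perm.SameCycle.apply_eq_of_invariant hf h

/-- The function on the medial vertices induced by a function on sides. -/
def liftMid {β : Type*} (f : F × Fin 4 → β) (hf : ∀ s, f (S.glue s) = f s) :
    S.MedialVertex → β :=
  Quotient.lift f fun _ _ h => Equiv.Perm.SameCycle.apply_eq_of_invariant hf h

@[simp]
theorem liftVertex_vertex {β : Type*} (f : F × Fin 4 → β) (hf : ∀ c, f (S.rot c) = f c)
    (c : F × Fin 4) : S.liftVertex f hf (S.vertex c) = f c := rfl

@[simp]
theorem liftMid_mid {β : Type*} (f : F × Fin 4 → β) (hf : ∀ s, f (S.glue s) = f s)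
    (s : F × Fin 4) : S.liftMid f hf (S.mid s) = f s := rfl

theorem rot_apply (c : F × Fin 4) : S.rot c = S.glue (c.1, c.2 - 1) := rfl

theorem vertex_rot (c : F × Fin 4) : S.vertex (S.rot c) = S.vertex c :=
  Quotient.sound (s := Equiv.Perm.SameCycle.setoid S.rot)
    (Equiv.Perm.sameCycle_apply_left.2 (Equiv.Perm.SameCycle.refl _ _))

theorem vertex_glue (s : F × Fin 4) : S.vertex (S.glue s) = S.vertex (s.1, s.2 + 1) := by
  rw [← S.vertex_rot (s.1, s.2 + 1), rot_apply]
  simp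

theorem vertex_glue_add_one (s : F × Fin 4) :
    S.vertex ((S.glue s).1, (S.glue s).2 + 1) = S.vertex s := by
  rw [← S.vertex_glue, S.glue_glue]

theorem mid_glue (s : F × Fin 4) : S.mid (S.glue s) = S.mid s :=
  Quotient.sound (s := Equiv.Perm.SameCycle.setoid S.glue)
    (Equiv.Perm.sameCycle_apply_left.2 (Equiv.Perm.SameCycle.refl _ _))

theorem even_rot (c : F × Fin 4) : Even ((S.rot c).2 : ℕ) ↔ Even (c.2 : ℕ) := by
  rw [rot_apply, S.bipartite]
  obtain ⟨Q, i⟩ := c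
  fin_cases i <;> simp <;> decide

/-- Whether a vertex is black. -/
def IsBlack : S.Vertex → Prop := S.liftVertex (fun c => Even (c.2 : ℕ)) fun c =>
  propext (S.even_rot c)

@[simp]
theorem isBlack_vertex (c : F × Fin 4) : S.IsBlack (S.vertex c) ↔ Even (c.2 : ℕ) := Iff.rfl

/-! ### Closed forms on the black and on the white graph -/

theorem sum_prod_fin_four {M : Type*} [AddCommMonoid M] (f : F × Fin 4 → M) :
    ∑ c, f c = ∑ Q : F, (f (Q, 0) + f (Q, 1) + f (Q, 2) + f (Q, 3)) := by
  rw [Fintype.sum_prod_type]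
  simp [Fin.sum_univ_four]

/-- Real 1-forms on the black graph, given by their values on the diagonals from `b₋` to `b₊`,
that are closed around white vertices. -/
def blackClosed : Submodule ℝ (F → ℝ) where
  carrier := {B | ∀ h : S.Vertex → ℝ,
    ∑ Q, B Q * (h (S.vertex (Q, 1)) - h (S.vertex (Q, 3))) = 0}
  zero_mem' := by simp
  add_mem' := fun {a b} ha hb h => by
    simp only [Pi.add_apply, add_mul, Finset.sum_add_distrib]
    rw [ha h, hb h, add_zero]
  smul_mem' := fun r a ha h => by
    simp only [Pi.smul_apply, smul_eq_mul, mul_assoc, ← Finset.mul_sum]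
    rw [ha h, mul_zero]

/-- Real 1-forms on the white graph, given by their values on the diagonals from `w₋` to `w₊`,
that are closed around black vertices. -/
def whiteClosed : Submodule ℝ (F → ℝ) where
  carrier := {W | ∀ h : S.Vertex → ℝ,
    ∑ Q, W Q * (h (S.vertex (Q, 2)) - h (S.vertex (Q, 0))) = 0}
  zero_mem' := by simp
  add_mem' := fun {a b} ha hb h => by
    simp only [Pi.add_apply, add_mul, Finset.sum_add_distrib]
    rw [ha h, hb h, add_zero]
  smul_mem' := fun r a ha h => by
    simp only [Pi.smul_apply, smul_eq_mul, mul_assoc, ← Finset.mul_sum]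
    rw [ha h, mul_zero]

theorem mem_blackClosed {B : F → ℝ} : B ∈ S.blackClosed ↔ ∀ h : S.Vertex → ℝ,
    ∑ Q, B Q * (h (S.vertex (Q, 1)) - h (S.vertex (Q, 3))) = 0 := Iff.rfl

theorem mem_whiteClosed {W : F → ℝ} : W ∈ S.whiteClosed ↔ ∀ h : S.Vertex → ℝ,
    ∑ Q, W Q * (h (S.vertex (Q, 2)) - h (S.vertex (Q, 0))) = 0 := Iff.rfl

/-- A sum over sides vanishes if the contributions of glued sides cancel. -/
theorem sum_eq_zero_of_glue_eq_neg (f : F × Fin 4 → ℝ) (hf : ∀ s, f (S.glue s) = -f s) :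
    ∑ s, f s = 0 := by
  have h : ∑ s, f s = -∑ s, f s := by
    conv_lhs => rw [← Equiv.sum_comp S.glue f]
    simp [hf]
  linarith

/-- The differential of a function on the black vertices. -/
def blackExact : (S.Vertex → ℝ) →ₗ[ℝ] (F → ℝ) where
  toFun h Q := h (S.vertex (Q, 2)) - h (S.vertex (Q, 0))
  map_add' h k := by
    funext Q
    simp only [Pi.add_apply]
    ring
  map_smul' r h := by
    funext Q
    simp only [Pi.smul_apply, smul_eq_mul, RingHom.id_apply]
    ring

/-- This is `d² = 0`, tested against `k`: the pairing is a sum over sides of `± h(black end) k(white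
end)`, the sign telling whether the side runs towards its black or its white end. Glued sides have
the same ends and opposite directions, so their terms cancel. -/
theorem blackExact_mem_blackClosed (h : S.Vertex → ℝ) : S.blackExact h ∈ S.blackClosed := by
  intro k
  classical
  let f : F × Fin 4 → ℝ := fun s =>
    if Even (s.2 : ℕ) then -(h (S.vertex s) * k (S.vertex (s.1, s.2 + 1)))
    else h (S.vertex (s.1, s.2 + 1)) * k (S.vertex s)
  have hf : ∑ s, f s = 0 := by
    refine S.sum_eq_zero_of_glue_eq_neg f fun s => ?_
    simp only [f, S.bipartite, S.vertex_glue, S.vertex_glue_add_one]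
    by_cases hs : Even (s.2 : ℕ) <;> simp [hs]
  rw [sum_prod_fin_four] at hf
  rw [← hf]
  refine Finset.sum_congr rfl fun Q _ => ?_
  have e3 : (3 : Fin 4) + 1 = 0 := rfl
  have e2 : (2 : Fin 4) + 1 = 3 := rfl
  have e1 : (1 : Fin 4) + 1 = 2 := rfl
  have p2 : Even ((2 : Fin 4) : ℕ) := by decide
  have p3 : ¬ Even ((3 : Fin 4) : ℕ) := by decide
  simp only [f, e1, e2, e3, p2, p3, blackExact, LinearMap.coe_mk, AddHom.coe_mk]
  simp
  ring

/-! ### Cycles -/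

/-- Summation by parts. Test functions that see only one end of each edge of `Λ` then extract the
white or the black part of a cycle. -/
theorem sum_mul_boundaryOne (k : S.MedialVertex → ℝ) (c : F × Fin 4 → ℤ) :
    ∑ m, k m * (S.boundaryOne c m : ℝ) =
      ∑ s, (c s : ℝ) * (k (S.mid s) - k (S.mid (s.1, s.2 - 1))) := by
  classical
  simp only [boundaryOne, LinearMap.sum_apply, LinearMap.smulRight_apply, LinearMap.proj_apply,
    Finset.sum_apply, Int.cast_sum, Finset.mul_sum]
  rw [Finset.sum_comm]
  refine Finset.sum_congr rfl fun s _ => ?_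
  simp only [Pi.smul_apply, Pi.sub_apply, smul_eq_mul, Int.cast_mul, Int.cast_sub, src, tgt,
    if_true, Pi.single_apply, Int.cast_ite, Int.cast_one, Int.cast_zero]
  simp only [mul_sub, Finset.sum_sub_distrib, mul_ite, mul_one, mul_zero, Finset.sum_ite_eq',
    Finset.mem_univ, if_true]
  ring

/-- The function on medial vertices, which are edges of `Λ`, given by a function on the white
ends of the edges. -/
noncomputable def whiteEnd (h : S.Vertex → ℝ) : S.MedialVertex → ℝ :=
  S.liftMid (fun s => open scoped Classical in
    if Even (s.2 : ℕ) then h (S.vertex (s.1, s.2 + 1)) else h (S.vertex s)) fun s => by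
      simp only [S.bipartite, S.vertex_glue, S.vertex_glue_add_one]
      by_cases hs : Even (s.2 : ℕ) <;> simp [hs]

/-- The function on medial vertices, which are edges of `Λ`, given by a function on the black
ends of the edges. -/
noncomputable def blackEnd (h : S.Vertex → ℝ) : S.MedialVertex → ℝ :=
  S.liftMid (fun s => open scoped Classical in
    if Even (s.2 : ℕ) then h (S.vertex s) else h (S.vertex (s.1, s.2 + 1))) fun s => by
      simp only [S.bipartite, S.vertex_glue, S.vertex_glue_add_one]
      by_cases hs : Even (s.2 : ℕ) <;> simp [hs]

/-- Poincaré duality: a white chain without boundary, read across the dual diagonals, is a closed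
black form. A test function of the white ends does not change along medial edges at white corners,
so only the white chain survives in the summation by parts. -/
theorem whiteChain_mem_blackClosed {c : F × Fin 4 → ℤ} (hc : c ∈ LinearMap.ker S.boundaryOne) :
    (fun Q => (whiteChain c Q : ℝ)) ∈ S.blackClosed := by
  intro h
  have H := S.sum_mul_boundaryOne (S.whiteEnd h) c
  rw [LinearMap.mem_ker.1 hc, sum_prod_fin_four] at H
  simp only [Pi.zero_apply, Int.cast_zero, mul_zero, Finset.sum_const_zero] at H
  rw [← neg_eq_zero, ← Finset.sum_neg_distrib, H]
  refine Finset.sum_congr rfl fun Q _ => ?_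
  have e : (0 : Fin 4) - 1 = 3 ∧ (1 : Fin 4) - 1 = 0 ∧ (2 : Fin 4) - 1 = 1 ∧
    (3 : Fin 4) - 1 = 2 ∧ (3 : Fin 4) + 1 = 0 ∧ (2 : Fin 4) + 1 = 3 ∧ (1 : Fin 4) + 1 = 2 ∧
    (0 : Fin 4) + 1 = 1 := by decide
  have p : Even ((0 : Fin 4) : ℕ) ∧ ¬ Even ((1 : Fin 4) : ℕ) ∧ Even ((2 : Fin 4) : ℕ) ∧
    ¬ Even ((3 : Fin 4) : ℕ) := by decide
  simp only [whiteEnd, liftMid_mid, e, p, if_true, if_false, whiteChain_apply]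
  push_cast
  ring

theorem blackChain_mem_whiteClosed {c : F × Fin 4 → ℤ} (hc : c ∈ LinearMap.ker S.boundaryOne) :
    (fun Q => (blackChain c Q : ℝ)) ∈ S.whiteClosed := by
  intro h
  have H := S.sum_mul_boundaryOne (S.blackEnd h) c
  rw [LinearMap.mem_ker.1 hc, sum_prod_fin_four] at H
  simp only [Pi.zero_apply, Int.cast_zero, mul_zero, Finset.sum_const_zero] at H
  rw [H]
  refine Finset.sum_congr rfl fun Q _ => ?_
  have e : (0 : Fin 4) - 1 = 3 ∧ (1 : Fin 4) - 1 = 0 ∧ (2 : Fin 4) - 1 = 1 ∧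
    (3 : Fin 4) - 1 = 2 ∧ (3 : Fin 4) + 1 = 0 ∧ (2 : Fin 4) + 1 = 3 ∧ (1 : Fin 4) + 1 = 2 ∧
    (0 : Fin 4) + 1 = 1 := by decide
  have p : Even ((0 : Fin 4) : ℕ) ∧ ¬ Even ((1 : Fin 4) : ℕ) ∧ Even ((2 : Fin 4) : ℕ) ∧
    ¬ Even ((3 : Fin 4) : ℕ) := by decide
  simp only [blackEnd, liftMid_mid, e, p, if_true, if_false, blackChain_apply]
  push_cast
  ring

end DiscreteRiemannSurface

namespace DiscreteRiemannSurface

variable {F : Type*} [Fintype F] (S : DiscreteRiemannSurface F)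

/-! ### Periods of real forms -/

/-- The integral of a 1-form on the black graph along the black 1-chain of a medial 1-chain. -/
def blackPairing (c : F × Fin 4 → ℤ) : (F → ℝ) →ₗ[ℝ] ℝ :=
  ∑ Q, (blackChain c Q : ℝ) • LinearMap.proj Q

/-- The integral of a 1-form on the white graph along the white 1-chain of a medial 1-chain. -/
def whitePairing (c : F × Fin 4 → ℤ) : (F → ℝ) →ₗ[ℝ] ℝ :=
  ∑ Q, (whiteChain c Q : ℝ) • LinearMap.proj Q

theorem blackPairing_apply (c : F × Fin 4 → ℤ) (B : F → ℝ) :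
    blackPairing c B = ∑ Q, (blackChain c Q : ℝ) * B Q := by
  simp [blackPairing]

theorem whitePairing_apply (c : F × Fin 4 → ℤ) (W : F → ℝ) :
    whitePairing c W = ∑ Q, (whiteChain c Q : ℝ) * W Q := by
  simp [whitePairing]

/-- The integral of a 1-form on the white graph as a functional on the medial 1-chains. -/
def whiteFunctional (W : F → ℝ) : (F × Fin 4 → ℤ) →ₗ[ℤ] ℝ :=
  AddMonoidHom.toIntLinearMap
    { toFun := fun c => whitePairing c W
      map_zero' := by simp [whitePairing_apply]
      map_add' := fun c d => by
        simp only [whitePairing_apply, map_add, Pi.add_apply, Int.cast_add, add_mul,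
          Finset.sum_add_distrib] }

theorem whiteFunctional_apply (W : F → ℝ) (c : F × Fin 4 → ℤ) :
    whiteFunctional W c = whitePairing c W := rfl

/-- The white chain of `P'`, read as a black form, is Poincaré dual to `P'`: its periods are
intersection numbers. -/
theorem blackPairing_whiteChain (P P' : List S.MedialDart) :
    blackPairing (S.chain P) (fun Q => (whiteChain (S.chain P') Q : ℝ)) =
      (S.intersection P P' : ℝ) := by
  simp [blackPairing_apply, intersection, blackCount, whiteCount, blackChain_apply,
    whiteChain_apply]

theorem whitePairing_blackChain (P P' : List S.MedialDart) :
    whitePairing (S.chain P') (fun Q => (blackChain (S.chain P) Q : ℝ)) =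
      (S.intersection P P' : ℝ) := by
  rw [← blackPairing_whiteChain, whitePairing_apply, blackPairing_apply]
  exact Finset.sum_congr rfl fun Q _ => mul_comm _ _

/-- A 1-form on the white graph whose integrals along all closed paths vanish is exact. -/
theorem exists_white_potential {W : F → ℝ}
    (hW : ∀ c ∈ LinearMap.ker S.boundaryOne, whitePairing c W = 0) :
    ∃ h : S.Vertex → ℝ, ∀ Q, W Q = h (S.vertex (Q, 3)) - h (S.vertex (Q, 1)) := by
  classical
  -- Since `W` vanishes on cycles, integration of `W` factors through boundaries. As `ℝ` is
  -- divisible, hence injective, the resulting functional extends to all 0-chains, and its values on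
  -- points are a potential on medial vertices.
  obtain ⟨ψ, hψ⟩ := (Module.Baer.of_divisible ℝ).extension_property
    ((LinearMap.ker S.boundaryOne).liftQ S.boundaryOne le_rfl)
    (LinearMap.ker_eq_bot.1 (Submodule.ker_liftQ_eq_bot _ _ _ le_rfl))
    ((LinearMap.ker S.boundaryOne).liftQ (whiteFunctional W) fun c hc => hW c hc)
  have hψ' : ∀ c, ψ (S.boundaryOne c) = whitePairing c W := fun c =>
    LinearMap.congr_fun hψ (Submodule.Quotient.mk c)
  let k : S.MedialVertex → ℝ := fun m => ψ (Pi.single m 1)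
  have hk : ∀ c : F × Fin 4,
      k (S.mid c) - k (S.mid (c.1, c.2 - 1)) = whitePairing (Pi.single c 1) W := fun c => by
    rw [← hψ', boundaryOne_single, map_sub]
    simp [k, src, tgt]
  -- Medial edges at white corners carry no part of a white form, so the potential is constant
  -- around each white vertex.
  have hodd : ∀ c : F × Fin 4, ¬ Even (c.2 : ℕ) → k (S.mid (c.1, c.2 - 1)) = k (S.mid c) := by
    rintro ⟨Q, i⟩ hi
    rw [eq_comm, ← sub_eq_zero, hk, whitePairing_apply]
    refine Finset.sum_eq_zero fun R _ => ?_
    have h2 : (2 : Fin 4) ≠ i := by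
      rintro rfl
      exact hi even_two
    have h0 : (0 : Fin 4) ≠ i := by
      rintro rfl
      exact hi Even.zero
    simp [whiteChain_apply, h2, h0]
  have hrot : ∀ c : F × Fin 4, (if Even ((S.rot c).2 : ℕ) then 0 else k (S.mid (S.rot c))) =
      if Even (c.2 : ℕ) then 0 else k (S.mid c) := fun c => by
    simp only [S.even_rot]
    split_ifs with hc
    · rfl
    · rw [rot_apply, mid_glue, hodd c hc]
  -- The value 0 at black vertices is arbitrary; only white vertices enter the conclusion.
  refine ⟨S.liftVertex (fun c => if Even (c.2 : ℕ) then 0 else k (S.mid c)) hrot, fun Q => ?_⟩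
  have p3 : ¬ Even ((3 : Fin 4) : ℕ) := by decide
  have p1 : ¬ Even ((1 : Fin 4) : ℕ) := by decide
  simp only [liftVertex_vertex, p3, p1, if_false]
  rw [← hodd (Q, 3) p3]
  have h2 := hk (Q, 2)
  have e3 : (3 : Fin 4) - 1 = 2 := rfl
  have e2 : (2 : Fin 4) - 1 = 1 := rfl
  simp only [e2, e3] at h2 ⊢
  rw [h2, whitePairing_apply, Finset.sum_eq_single Q]
  · simp [whiteChain_apply]
  · intro R _ hR
    simp [whiteChain_apply, hR]
  · simp

variable {S} {g : ℕ} (H : S.CanonicalHomologyBasis g)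

/-- The 1-chains of the closed paths of a canonical homology basis. -/
noncomputable def CanonicalHomologyBasis.cycleChain (k : Fin g ⊕ Fin g) : F × Fin 4 → ℤ :=
  S.chain (H.cycle k).1

theorem CanonicalHomologyBasis.cycleChain_mem_ker (k : Fin g ⊕ Fin g) :
    H.cycleChain k ∈ LinearMap.ker S.boundaryOne := S.chain_mem_ker _

theorem CanonicalHomologyBasis.intersection_cycle (k l : Fin g ⊕ Fin g) :
    S.intersection (H.cycle k).1 (H.cycle l).1 =
      Matrix.fromBlocks (0 : Matrix (Fin g) (Fin g) ℤ) 1 (-1) 0 k l := by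
  rw [← H.intersection_eq, Matrix.of_apply]

/-- A closed 1-form on the white graph is exact if its periods along a homology basis vanish. -/
theorem CanonicalHomologyBasis.whitePairing_eq_zero {W : F → ℝ} (hW : W ∈ S.whiteClosed)
    (h0 : ∀ k, whitePairing (H.cycleChain k) W = 0) (c : F × Fin 4 → ℤ)
    (hc : c ∈ LinearMap.ker S.boundaryOne) : whitePairing c W = 0 := by
  -- Boundaries have zero integral: face boundaries have no white part, and vertex boundaries are
  -- handled by closedness of `W`. Thus integration descends to homology and is determined on
  -- generators.
  have hle : (LinearMap.range S.boundaryTwo).submoduleOf (LinearMap.ker S.boundaryOne) ≤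
      LinearMap.ker ((whiteFunctional W).comp (LinearMap.ker S.boundaryOne).subtype) := by
    rintro ⟨_, _⟩ ⟨⟨m, n⟩, rfl⟩
    simp only [LinearMap.mem_ker, LinearMap.comp_apply, Submodule.subtype_apply,
      whiteFunctional_apply, whitePairing_apply]
    rw [← neg_eq_zero, ← Finset.sum_neg_distrib, ← hW fun v => (n v : ℝ)]
    refine Finset.sum_congr rfl fun Q _ => ?_
    simp only [whiteChain_apply, boundaryTwo, LinearMap.coe_mk, AddHom.coe_mk]
    push_cast
    ring
  have h := LinearMap.ext_on (f := Submodule.liftQ _ _ hle) (g := 0) H.span_eq_top <| by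
    rintro _ ⟨k, rfl⟩
    exact h0 k
  exact LinearMap.congr_fun h (Submodule.Quotient.mk ⟨c, hc⟩)

/-- The discrete Riemann bilinear identity for a closed 1-form on the black graph and a closed
1-form on the white graph. -/
theorem CanonicalHomologyBasis.sum_mul_eq {B W : F → ℝ} (hB : B ∈ S.blackClosed)
    (hW : W ∈ S.whiteClosed) :
    ∑ Q, B Q * W Q = ∑ j : Fin g,
      (blackPairing (H.cycleChain (Sum.inl j)) B * whitePairing (H.cycleChain (Sum.inr j)) W -
        blackPairing (H.cycleChain (Sum.inr j)) B *
          whitePairing (H.cycleChain (Sum.inl j)) W) := by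
  -- The coefficients solve the linear system given by the intersection matrix, so that `∑ k, y k •
  -- β k` has the same periods as `W`.
  let y : Fin g ⊕ Fin g → ℝ := Sum.elim (fun j => whitePairing (H.cycleChain (Sum.inr j)) W)
    (fun j => -whitePairing (H.cycleChain (Sum.inl j)) W)
  let β : Fin g ⊕ Fin g → F → ℝ := fun k Q => (blackChain (H.cycleChain k) Q : ℝ)
  have hβ : ∀ k l, whitePairing (H.cycleChain l) (β k) =
      (Matrix.fromBlocks (0 : Matrix (Fin g) (Fin g) ℤ) 1 (-1) 0 k l : ℤ) := fun k l => by
    rw [← H.intersection_cycle, ← whitePairing_blackChain]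
    rfl
  let W' : F → ℝ := W - ∑ k, y k • β k
  have hW' : W' ∈ S.whiteClosed := Submodule.sub_mem _ hW <| Submodule.sum_mem _ fun k _ =>
    Submodule.smul_mem _ _ (S.blackChain_mem_whiteClosed (H.cycleChain_mem_ker k))
  have h0 : ∀ l, whitePairing (H.cycleChain l) W' = 0 := fun l => by
    rw [map_sub, map_sum]
    simp only [map_smul, hβ, Fintype.sum_sum_type]
    cases l <;> simp [y, Matrix.one_apply, Matrix.neg_apply]
  obtain ⟨h, hh⟩ := S.exists_white_potential (H.whitePairing_eq_zero hW' h0)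
  -- `W'` is exact, and the closed form `B` is orthogonal to exact white forms. Only the Poincaré
  -- duals contribute to the sum, and they pair with `B` to its periods.
  have hBW' : ∑ Q, B Q * W' Q = 0 := by
    rw [← neg_eq_zero, ← Finset.sum_neg_distrib, ← hB h]
    refine Finset.sum_congr rfl fun Q _ => ?_
    rw [hh]
    ring
  have hsplit : ∑ Q, B Q * W' Q = ∑ Q, B Q * W Q - ∑ k, y k * blackPairing (H.cycleChain k) B := by
    simp only [W', blackPairing_apply, Pi.sub_apply, Finset.sum_apply, Pi.smul_apply, smul_eq_mul,
      mul_sub, Finset.sum_sub_distrib, Finset.mul_sum]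
    rw [Finset.sum_comm (s := (Finset.univ : Finset F))]
    congr 1
    exact Finset.sum_congr rfl fun k _ => Finset.sum_congr rfl fun Q _ => by
      simp only [β]
      ring
  rw [hBW', eq_comm, sub_eq_zero] at hsplit
  rw [hsplit, Fintype.sum_sum_type, ← Finset.sum_add_distrib]
  refine Finset.sum_congr rfl fun j _ => ?_
  simp only [y, Sum.elim_inl, Sum.elim_inr]
  ring

end DiscreteRiemannSurface

namespace DiscreteRiemannSurface

variable {F : Type*} [Fintype F] (S : DiscreteRiemannSurface F)

/-! ### Discrete harmonic forms -/

/-- Closed real 1-forms `B` on the black graph such that `r B` is closed on the white graph. -/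
def harmonicForms (r : F → ℝ) : Submodule ℝ (F → ℝ) :=
  S.blackClosed ⊓ S.whiteClosed.comap (LinearMap.mulLeft ℝ r)

theorem mem_harmonicForms {r B : F → ℝ} :
    B ∈ S.harmonicForms r ↔ B ∈ S.blackClosed ∧ r * B ∈ S.whiteClosed := Iff.rfl

/-- The weighted inner product on functions. -/
def weightedForm {E : Type*} [Fintype E] (r : E → ℝ) : LinearMap.BilinForm ℝ (E → ℝ) :=
  LinearMap.mk₂ ℝ (fun u v => ∑ Q, r Q * u Q * v Q)
    (fun u v w => by simp only [Pi.add_apply, mul_add, add_mul, Finset.sum_add_distrib])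
    (fun a u v => by
      simp only [Pi.smul_apply, smul_eq_mul, Finset.mul_sum]
      exact Finset.sum_congr rfl fun Q _ => by ring)
    (fun u v w => by simp only [Pi.add_apply, mul_add, Finset.sum_add_distrib])
    (fun a u v => by
      simp only [Pi.smul_apply, smul_eq_mul, Finset.mul_sum]
      exact Finset.sum_congr rfl fun Q _ => by ring)

theorem weightedForm_apply {E : Type*} [Fintype E] (r u v : E → ℝ) :
    weightedForm r u v = ∑ Q, r Q * u Q * v Q := rfl

theorem eq_zero_of_weightedForm_self {E : Type*} [Fintype E] {r : E → ℝ} (hr : ∀ Q, 0 < r Q)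
    {u : E → ℝ} (hu : weightedForm r u u = 0) : u = 0 := by
  rw [weightedForm_apply, Finset.sum_eq_zero_iff_of_nonneg fun Q _ => by
    rw [mul_assoc]
    exact mul_nonneg (hr Q).le (mul_self_nonneg _)] at hu
  funext Q
  have := hu Q (Finset.mem_univ Q)
  simpa [(hr Q).ne'] using this

/-- Hodge decomposition: each closed form is the sum of an exact and a harmonic one. -/
theorem exists_sub_blackExact_mem_harmonicForms {r : F → ℝ} (hr : ∀ Q, 0 < r Q) {B : F → ℝ}
    (hB : B ∈ S.blackClosed) :
    ∃ h : S.Vertex → ℝ, B - S.blackExact h ∈ S.harmonicForms r := by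
  have hrefl : (weightedForm r).IsRefl := fun u v h => by
    rw [weightedForm_apply] at h ⊢
    rw [← h]
    exact Finset.sum_congr rfl fun Q _ => by ring
  -- Positive weights make the form definite, so exact forms meet their orthogonal complement
  -- trivially and the two span everything.
  have hdisj : Disjoint (LinearMap.range S.blackExact)
      ((weightedForm r).orthogonal (LinearMap.range S.blackExact)) := by
    rw [Submodule.disjoint_def]
    exact fun u hu hu' => eq_zero_of_weightedForm_self hr (hu' u hu)
  have hsup := ((LinearMap.BilinForm.isCompl_orthogonal_iff_disjoint hrefl).2 hdisj).sup_eq_top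
  obtain ⟨_, ⟨h, rfl⟩, n, hn, hsum⟩ := Submodule.mem_sup.1 (hsup ▸ Submodule.mem_top (x := B))
  refine ⟨h, Submodule.sub_mem _ hB (S.blackExact_mem_blackClosed h), fun k => ?_⟩
  -- Weighted orthogonality of `n` to every exact form is precisely closedness of `r n` on the white
  -- graph.
  rw [← hn _ ⟨k, rfl⟩, weightedForm_apply]
  refine Finset.sum_congr rfl fun Q _ => ?_
  rw [← hsum, add_sub_cancel_left]
  simp only [LinearMap.mulLeft_apply, Pi.mul_apply, blackExact, LinearMap.coe_mk, AddHom.coe_mk]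
  ring

theorem blackPairing_blackExact {c : F × Fin 4 → ℤ} (hc : c ∈ LinearMap.ker S.boundaryOne)
    (h : S.Vertex → ℝ) : blackPairing c (S.blackExact h) = 0 := by
  rw [blackPairing_apply]
  exact S.blackChain_mem_whiteClosed hc h

variable {S} {g : ℕ} (H : S.CanonicalHomologyBasis g)

/-- All black periods of harmonic forms. -/
noncomputable def CanonicalHomologyBasis.blackPeriods (r : F → ℝ) :
    S.harmonicForms r →ₗ[ℝ] (Fin g ⊕ Fin g → ℝ) :=
  LinearMap.pi fun k => (blackPairing (H.cycleChain k)).comp (Submodule.subtype _)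

/-- The black `a`-periods of harmonic forms `B` and the white `a`-periods of `r B`. -/
noncomputable def CanonicalHomologyBasis.aPeriods (r : F → ℝ) :
    S.harmonicForms r →ₗ[ℝ] (Fin g ⊕ Fin g → ℝ) :=
  LinearMap.pi (Sum.elim
    (fun j => (blackPairing (H.cycleChain (Sum.inl j))).comp (Submodule.subtype _))
    (fun j => ((whitePairing (H.cycleChain (Sum.inl j))).comp (LinearMap.mulLeft ℝ r)).comp
      (Submodule.subtype _)))

/-- Combinations of Poincaré duals of the basis cycles realize all period vectors, because the
intersection matrix is invertible; subtracting an exact form makes them harmonic without changing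
periods. -/
theorem CanonicalHomologyBasis.blackPeriods_surjective {r : F → ℝ} (hr : ∀ Q, 0 < r Q) :
    Function.Surjective (H.blackPeriods r) := by
  intro x
  let y : Fin g ⊕ Fin g → ℝ := Sum.elim (fun j => -x (Sum.inr j)) (fun j => x (Sum.inl j))
  let β : Fin g ⊕ Fin g → F → ℝ := fun k Q => (whiteChain (H.cycleChain k) Q : ℝ)
  have hβ : ∀ k l, blackPairing (H.cycleChain l) (β k) =
      (Matrix.fromBlocks (0 : Matrix (Fin g) (Fin g) ℤ) 1 (-1) 0 l k : ℤ) := fun k l => by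
    rw [← H.intersection_cycle, ← blackPairing_whiteChain]
    rfl
  have hB : ∑ k, y k • β k ∈ S.blackClosed := Submodule.sum_mem _ fun k _ =>
    Submodule.smul_mem _ _ (S.whiteChain_mem_blackClosed (H.cycleChain_mem_ker k))
  obtain ⟨h, hh⟩ := S.exists_sub_blackExact_mem_harmonicForms hr hB
  refine ⟨⟨_, hh⟩, ?_⟩
  funext l
  simp only [blackPeriods, LinearMap.pi_apply, LinearMap.comp_apply, Submodule.subtype_apply]
  rw [map_sub, S.blackPairing_blackExact (H.cycleChain_mem_ker l), sub_zero, map_sum]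
  simp only [map_smul, hβ, Fintype.sum_sum_type]
  cases l <;> simp [y, Matrix.one_apply, Matrix.neg_apply]

/-- In the bilinear identity for `B` and `W = r B`, each term contains an `a`-period. If these
vanish, so does the weighted norm `∑ r B²`. -/
theorem CanonicalHomologyBasis.aPeriods_injective {r : F → ℝ} (hr : ∀ Q, 0 < r Q) :
    Function.Injective (H.aPeriods r) := by
  rw [← LinearMap.ker_eq_bot, LinearMap.ker_eq_bot']
  rintro ⟨B, hB⟩ h0
  have hblack : ∀ j, blackPairing (H.cycleChain (Sum.inl j)) B = 0 := fun j =>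
    congrFun h0 (Sum.inl j)
  have hwhite : ∀ j, whitePairing (H.cycleChain (Sum.inl j)) (r * B) = 0 := fun j =>
    congrFun h0 (Sum.inr j)
  have h := H.sum_mul_eq hB.1 hB.2
  simp only [LinearMap.mulLeft_apply, hblack, hwhite, zero_mul, mul_zero, sub_zero,
    Finset.sum_const_zero] at h
  rw [Submodule.mk_eq_zero]
  refine eq_zero_of_weightedForm_self hr ?_
  rw [weightedForm_apply, ← h]
  exact Finset.sum_congr rfl fun Q _ => mul_comm _ _

/-- A dimension count: injectivity of `aPeriods` bounds the dimension of the harmonic forms by `2g`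
from above, surjectivity of `blackPeriods` from below. -/
theorem CanonicalHomologyBasis.aPeriods_bijective {r : F → ℝ} (hr : ∀ Q, 0 < r Q) :
    Function.Bijective (H.aPeriods r) := by
  have hi := H.aPeriods_injective hr
  have hf := (LinearMap.finrank_le_finrank_of_injective hi).antisymm
    (LinearMap.finrank_le_finrank_of_surjective (H.blackPeriods_surjective hr))
  exact ⟨hi, (LinearMap.injective_iff_surjective_of_finrank_eq_finrank hf).1 hi⟩

end DiscreteRiemannSurface

namespace DiscreteRiemannSurface

variable {F : Type*} [Fintype F] (S : DiscreteRiemannSurface F)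

/-! ### Holomorphic differentials on orthodiagonal surfaces -/

variable {S} in
theorem Orthodiagonal.rho_eq (hS : S.Orthodiagonal) (Q : F) : S.rho Q = ((S.rho Q).re : ℂ) :=
  Complex.ext rfl (hS Q)

theorem diagonal_ne_zero (Q : F) : S.z Q 2 - S.z Q 0 ≠ 0 := fun h => by
  simpa [h] using (S.embedded Q).1

theorem white_diagonal_eq (Q : F) :
    S.z Q 3 - S.z Q 1 = Complex.I * S.rho Q * (S.z Q 2 - S.z Q 0) := by
  rw [rho, ← mul_assoc, mul_neg, Complex.I_mul_I, neg_neg, one_mul,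
    div_mul_cancel₀ _ (S.diagonal_ne_zero Q)]

/-- Twice the signed area of the face equals `|b₊ - b₋|² Re ρ`. -/
theorem rho_re_pos (Q : F) : 0 < (S.rho Q).re := by
  have h := (S.embedded Q).1
  rw [white_diagonal_eq] at h
  have hmul : 0 < Complex.normSq (S.z Q 2 - S.z Q 0) * (S.rho Q).re := by
    convert h using 1
    simp [Complex.normSq_apply]
    ring
  exact (pos_iff_pos_of_mul_pos hmul).1 (Complex.normSq_pos.2 (S.diagonal_ne_zero Q))

/-- The differential with the values `p` and `i r p` on the black and the white diagonals. -/
noncomputable def ofForm (r : F → ℝ) (p : F → ℂ) : S.Differential := fun c =>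
  ![-(Complex.I * r c.1 * p c.1), p c.1, Complex.I * r c.1 * p c.1, -p c.1] c.2

theorem isTypeDiamond_ofForm (r : F → ℝ) (p : F → ℂ) : S.IsTypeDiamond (S.ofForm r p) := by
  intro Q i
  fin_cases i <;> simp [ofForm]

theorem sum_mul_ofReal_eq_zero_iff {ι : Type*} (s : Finset ι) (p : ι → ℂ) (x : ι → ℝ) :
    ∑ i ∈ s, p i * (x i : ℂ) = 0 ↔ ∑ i ∈ s, (p i).re * x i = 0 ∧ ∑ i ∈ s, (p i).im * x i = 0 := by
  simp [Complex.ext_iff]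

theorem sum_vertex_mul (ω : S.Differential) (h : S.Vertex → ℝ) :
    ∑ c, (h (S.vertex c) : ℂ) * ω c = open scoped Classical in
      ∑ v, (h v : ℂ) * ∑ c, (if S.vertex c = v then ω c else 0) := by
  classical
  simp only [Finset.mul_sum]
  rw [Finset.sum_comm]
  simp

/-- Weak form of closedness around vertices; real test functions suffice because they include
indicators of single vertices. -/
theorem isClosed_iff (ω : S.Differential) : S.IsClosed ω ↔
    (∀ Q : F, ∑ i : Fin 4, ω (Q, i) = 0) ∧
      ∀ h : S.Vertex → ℝ, ∑ c, (h (S.vertex c) : ℂ) * ω c = 0 := by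
  classical
  refine and_congr_right fun _ => ⟨fun hω h => ?_, fun hω v => ?_⟩
  · rw [sum_vertex_mul]
    exact Finset.sum_eq_zero fun v _ => by rw [hω, mul_zero]
  · refine Eq.trans (Finset.sum_congr rfl fun c _ => ?_) (hω fun w => if w = v then 1 else 0)
    split_ifs <;> simp

theorem sum_mul_ofForm (r : F → ℝ) (p : F → ℂ) (h : S.Vertex → ℝ) :
    ∑ c, (h (S.vertex c) : ℂ) * S.ofForm r p c =
      ∑ Q, p Q * ((h (S.vertex (Q, 1)) - h (S.vertex (Q, 3)) : ℝ) : ℂ) +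
      Complex.I * ∑ Q, p Q * ((r Q * (h (S.vertex (Q, 2)) - h (S.vertex (Q, 0))) : ℝ) : ℂ) := by
  rw [sum_prod_fin_four, Finset.mul_sum, ← Finset.sum_add_distrib]
  refine Finset.sum_congr rfl fun Q _ => ?_
  simp [ofForm]
  ring

/-- The point where reality of `r` matters: both closedness conditions on `p` have real
coefficients, so they hold for `Re p` and `Im p` separately. -/
theorem isClosed_ofForm_iff (r : F → ℝ) (p : F → ℂ) : S.IsClosed (S.ofForm r p) ↔
    (fun Q => (p Q).re) ∈ S.harmonicForms r ∧ (fun Q => (p Q).im) ∈ S.harmonicForms r := by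
  classical
  have key : (∀ h : S.Vertex → ℝ, ∑ c, (h (S.vertex c) : ℂ) * S.ofForm r p c = 0) ↔
      (∀ h : S.Vertex → ℝ,
        ∑ Q, p Q * ((h (S.vertex (Q, 1)) - h (S.vertex (Q, 3)) : ℝ) : ℂ) = 0) ∧
      (∀ h : S.Vertex → ℝ,
        ∑ Q, p Q * ((r Q * (h (S.vertex (Q, 2)) - h (S.vertex (Q, 0))) : ℝ) : ℂ) = 0) := by
    refine ⟨fun H => ⟨fun h => ?_, fun h => ?_⟩, fun H h => ?_⟩
    -- Test functions supported on white vertices isolate the black form; those supported on black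
    -- vertices, used next, isolate the white form.
    · have := (S.sum_mul_ofForm r p fun v => if S.IsBlack v then 0 else h v).symm.trans
        (H fun v => if S.IsBlack v then 0 else h v)
      simpa [show ¬ Even 3 by decide] using this
    · have := (S.sum_mul_ofForm r p fun v => if S.IsBlack v then h v else 0).symm.trans
        (H fun v => if S.IsBlack v then h v else 0)
      simpa [show ¬ Even 3 by decide] using this
    · rw [sum_mul_ofForm, H.1, H.2, mul_zero, add_zero]
  rw [isClosed_iff, key]
  simp only [sum_mul_ofReal_eq_zero_iff, mem_harmonicForms, mem_blackClosed, mem_whiteClosed,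
    forall_and, Pi.mul_apply]
  have hface : ∀ Q : F, ∑ i : Fin 4, S.ofForm r p (Q, i) = 0 := fun Q => by
    simp [ofForm, Fin.sum_univ_four]
  have hcomm : ∀ a b c : ℝ, a * (b * c) = b * a * c := fun a b c => by ring
  simp only [hface, implies_true, true_and, hcomm]
  tauto

variable {S} in
theorem Orthodiagonal.isHolomorphic_iff (hS : S.Orthodiagonal) (ω : S.Differential) :
    S.IsHolomorphic ω ↔ ∃ p : F → ℂ, ω = S.ofForm (fun Q => (S.rho Q).re) p ∧
      (fun Q => (p Q).re) ∈ S.harmonicForms (fun Q => (S.rho Q).re) ∧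
      (fun Q => (p Q).im) ∈ S.harmonicForms (fun Q => (S.rho Q).re) := by
  have hw : ∀ Q, S.z Q 3 - S.z Q 1 =
      Complex.I * ((S.rho Q).re : ℂ) * (S.z Q 2 - S.z Q 0) := fun Q => by
    rw [← hS.rho_eq, white_diagonal_eq]
  have e : (0 : Fin 4) - 1 = 3 ∧ (1 : Fin 4) - 1 = 0 ∧ (2 : Fin 4) - 1 = 1 ∧
    (3 : Fin 4) - 1 = 2 ∧ (3 : Fin 4) + 1 = 0 ∧ (2 : Fin 4) + 1 = 3 ∧ (1 : Fin 4) + 1 = 2 ∧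
    (0 : Fin 4) + 1 = 1 := by decide
  constructor
  · rintro ⟨-, h2, h3⟩
    have hω : ω = S.ofForm (fun Q => (S.rho Q).re) fun Q => ω (Q, 1) := by
      funext ⟨Q, i⟩
      obtain ⟨q, hq⟩ := h3 Q
      have h := hw Q
      fin_cases i <;> simp [ofForm, hq, dz, e]
      · linear_combination -(q / 2) * h
      · linear_combination (q / 2) * h
      · ring
    refine ⟨_, hω, ?_⟩
    rw [hω] at h2
    exact (S.isClosed_ofForm_iff _ _).1 h2
  · rintro ⟨p, rfl, hp⟩
    -- The factor 2 appears because medial edges are half as long as the diagonals, so `dz` at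
    -- corner 1 is half of `b₊ - b₋`.
    refine ⟨S.isTypeDiamond_ofForm _ _, (S.isClosed_ofForm_iff _ _).2 hp, fun Q =>
      ⟨2 * p Q / (S.z Q 2 - S.z Q 0), fun i => ?_⟩⟩
    have h := hw Q
    have hd := S.diagonal_ne_zero Q
    fin_cases i <;> simp [ofForm, dz, e] <;> field_simp
    · linear_combination p Q * h
    · ring
    · linear_combination -p Q * h
    · ring

/-! ### Periods -/

/-- Converts integrals along part of a path into pairings with its chain, since the filter depends
only on the unoriented edge. -/
theorem integral_filter (ω : S.Differential) (q : F × Fin 4 → Bool) (P : List S.MedialDart) :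
    S.integral ω (P.filter fun e => q e.1) =
      ∑ c, (S.chain P c : ℂ) * if q c then ω c else 0 := by
  classical
  induction P with
  | nil => simp [integral, chain]
  | cons e P ih =>
    have hc : S.chain (e :: P) = S.dartChain e + S.chain P := by simp [chain]
    have hi : S.integral ω ((e :: P).filter fun e => q e.1) =
        (if q e.1 then S.value ω e else 0) + S.integral ω (P.filter fun e => q e.1) := by
      by_cases hq : q e.1 <;> simp [integral, hq]
    rw [hi, ih, hc]
    simp only [Pi.add_apply, Int.cast_add, add_mul, Finset.sum_add_distrib]
    congr 1
    obtain ⟨c, b⟩ := e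
    rw [Finset.sum_eq_single c]
    · cases b <;> by_cases hq : q c <;> simp [dartChain, value, hq]
    · intro d _ hd
      cases b <;> simp [dartChain, hd]
    · simp

theorem blackPeriod_ofForm (r : F → ℝ) (p : F → ℂ) (P : List S.MedialDart) :
    S.blackPeriod (S.ofForm r p) P = 2 * (blackPairing (S.chain P) fun Q => (p Q).re) +
      2 * (blackPairing (S.chain P) fun Q => (p Q).im) * Complex.I := by
  rw [blackPeriod, blackPart, S.integral_filter _ fun c => decide (¬ Even (c.2 : ℕ)),
    sum_prod_fin_four, blackPairing_apply, blackPairing_apply]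
  push_cast
  rw [mul_assoc, Finset.sum_mul, ← mul_add, ← Finset.sum_add_distrib]
  congr 1
  refine Finset.sum_congr rfl fun Q _ => ?_
  simp [ofForm, blackChain_apply, show ¬ Even 3 by decide]
  linear_combination -(S.chain P (Q, 1) - S.chain P (Q, 3) : ℂ) * Complex.re_add_im (p Q)

theorem whitePeriod_ofForm (r : F → ℝ) (p : F → ℂ) (P : List S.MedialDart) :
    S.whitePeriod (S.ofForm r p) P =
      2 * (whitePairing (S.chain P) (r * fun Q => (p Q).re)) * Complex.I -
        2 * (whitePairing (S.chain P) (r * fun Q => (p Q).im)) := by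
  rw [whitePeriod, whitePart, S.integral_filter _ fun c => decide (Even (c.2 : ℕ)),
    sum_prod_fin_four, whitePairing_apply, whitePairing_apply]
  push_cast
  rw [mul_assoc, Finset.sum_mul, ← mul_sub, ← Finset.sum_sub_distrib]
  congr 1
  refine Finset.sum_congr rfl fun Q _ => ?_
  simp [ofForm, whiteChain_apply, show ¬ Even 3 by decide]
  linear_combination -(Complex.I * r Q * (S.chain P (Q, 2) - S.chain P (Q, 0) : ℂ)) *
    Complex.re_add_im (p Q) +
    (r Q * (p Q).im * (S.chain P (Q, 2) - S.chain P (Q, 0)) : ℂ) * Complex.I_mul_I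

end DiscreteRiemannSurface

namespace DiscreteRiemannSurface

variable {F : Type*} [Fintype F] {S : DiscreteRiemannSurface F} {g : ℕ}
  (H : S.CanonicalHomologyBasis g)

/-! ### The canonical basis of holomorphic differentials -/

theorem CanonicalHomologyBasis.aPeriods_inl {r : F → ℝ} (u : S.harmonicForms r) (j : Fin g) :
    H.aPeriods r u (Sum.inl j) = blackPairing (S.chain (H.a j)) u.1 := rfl

theorem CanonicalHomologyBasis.aPeriods_inr {r : F → ℝ} (u : S.harmonicForms r) (j : Fin g) :
    H.aPeriods r u (Sum.inr j) = whitePairing (S.chain (H.a j)) (r * u.1) := rfl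

/-- The harmonic forms whose `a`-periods are, up to the factor `2`, the standard basis. -/
noncomputable def CanonicalHomologyBasis.dualForm (k : Fin g ⊕ Fin g) :
    S.harmonicForms (fun Q => (S.rho Q).re) :=
  (LinearEquiv.ofBijective (H.aPeriods _) (H.aPeriods_bijective S.rho_re_pos)).symm
    (Pi.single k (1 / 2))

theorem CanonicalHomologyBasis.aPeriods_dualForm (k : Fin g ⊕ Fin g) :
    H.aPeriods _ (H.dualForm k) = Pi.single k (1 / 2) :=
  (LinearEquiv.ofBijective (H.aPeriods _) (H.aPeriods_bijective S.rho_re_pos)).apply_symm_apply _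

/-- Real and imaginary parts of the period conditions are conditions on the `a`-periods of `Re p`
and `Im p`. Those of `Im p` all vanish, so `Im p = 0`; those of `Re p` are the ones of the dual
form, with 1/2 compensating the factor 2 in the periods. -/
theorem isOmegaB_iff (hS : S.Orthodiagonal) (k : Fin g) (ω : S.Differential) :
    IsOmegaB H k ω ↔ ω = S.ofForm (fun Q => (S.rho Q).re)
      (fun Q => ((H.dualForm (Sum.inl k)).1 Q : ℂ)) := by
  have inj := H.aPeriods_injective S.rho_re_pos
  constructor
  · rintro ⟨hω, hper⟩
    obtain ⟨p, rfl, hre, him⟩ := (hS.isHolomorphic_iff ω).1 hω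
    simp only [blackPeriod_ofForm, whitePeriod_ofForm] at hper
    have h1 : (⟨_, hre⟩ : S.harmonicForms _) = H.dualForm (Sum.inl k) := by
      apply inj
      rw [H.aPeriods_dualForm]
      funext i
      rcases i with j | j
      · have := congrArg Complex.re (hper j).1
        rw [H.aPeriods_inl]
        by_cases hj : j = k <;> simp [hj] at this ⊢ <;> linarith
      · have := congrArg Complex.im (hper j).2
        rw [H.aPeriods_inr]
        simpa using this
    have h2 : (⟨_, him⟩ : S.harmonicForms _) = 0 := by
      apply inj
      rw [map_zero]
      funext i
      rcases i with j | j
      · have := congrArg Complex.im (hper j).1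
        rw [H.aPeriods_inl]
        by_cases hj : j = k <;> simpa [hj] using this
      · have := congrArg Complex.re (hper j).2
        rw [H.aPeriods_inr]
        simpa using this
    congr 1
    funext Q
    refine Complex.ext ?_ ?_
    · simp [← h1]
    · simpa using congrFun (congrArg Subtype.val h2) Q
  · rintro rfl
    refine ⟨(hS.isHolomorphic_iff _).2 ⟨_, rfl, by simp,
      Submodule.zero_mem (S.harmonicForms _)⟩,
      fun j => ?_⟩
    have h1 := congrFun (H.aPeriods_dualForm (Sum.inl k)) (Sum.inl j)
    have h2 := congrFun (H.aPeriods_dualForm (Sum.inl k)) (Sum.inr j)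
    rw [H.aPeriods_inl] at h1
    rw [H.aPeriods_inr] at h2
    have h0 : ∀ c : F × Fin 4 → ℤ, blackPairing c (fun _ : F => (0 : ℝ)) = 0 := fun c =>
      map_zero (blackPairing c)
    have h0' : ∀ r : F → ℝ, r * (fun _ : F => (0 : ℝ)) = 0 := fun r => mul_zero r
    simp only [blackPeriod_ofForm, whitePeriod_ofForm, Complex.ofReal_re, Complex.ofReal_im, h0,
      h0', map_zero]
    constructor
    · rw [h1]
      by_cases hj : j = k <;> simp [hj]
    · rw [h2]
      simp

/-- White periods carry a factor `i`, so a real white `a`-period comes from `Im p`, with a minus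
sign from `i² = -1`; all `a`-periods of `Re p` vanish. -/
theorem isOmegaW_iff (hS : S.Orthodiagonal) (k : Fin g) (ω : S.Differential) :
    IsOmegaW H k ω ↔ ω = S.ofForm (fun Q => (S.rho Q).re)
      (fun Q => ((-(H.dualForm (Sum.inr k)).1 Q : ℝ) : ℂ) * Complex.I) := by
  have inj := H.aPeriods_injective S.rho_re_pos
  constructor
  · rintro ⟨hω, hper⟩
    obtain ⟨p, rfl, hre, him⟩ := (hS.isHolomorphic_iff ω).1 hω
    simp only [blackPeriod_ofForm, whitePeriod_ofForm] at hper
    have h1 : (⟨_, him⟩ : S.harmonicForms _) = -H.dualForm (Sum.inr k) := by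
      apply inj
      rw [map_neg, H.aPeriods_dualForm]
      funext i
      rcases i with j | j
      · have := congrArg Complex.im (hper j).2
        rw [H.aPeriods_inl]
        simpa using this
      · have := congrArg Complex.re (hper j).1
        rw [H.aPeriods_inr]
        by_cases hj : j = k <;> simp [hj] at this ⊢ <;> linarith
    have h2 : (⟨_, hre⟩ : S.harmonicForms _) = 0 := by
      apply inj
      rw [map_zero]
      funext i
      rcases i with j | j
      · have := congrArg Complex.re (hper j).2
        rw [H.aPeriods_inl]
        simpa using this
      · have := congrArg Complex.im (hper j).1
        rw [H.aPeriods_inr]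
        by_cases hj : j = k <;> simpa [hj] using this
    congr 1
    funext Q
    refine Complex.ext ?_ ?_
    · simpa using congrFun (congrArg Subtype.val h2) Q
    · simpa using congrFun (congrArg Subtype.val h1) Q
  · rintro rfl
    have hre : ∀ x : ℝ, ((x : ℂ) * Complex.I).re = 0 := fun x => by simp
    have him : ∀ x : ℝ, ((x : ℂ) * Complex.I).im = x := fun x => by simp
    have hn : (fun Q => -(H.dualForm (Sum.inr k)).1 Q) = (-H.dualForm (Sum.inr k)).1 := rfl
    refine ⟨(hS.isHolomorphic_iff _).2 ⟨_, rfl, ?_, ?_⟩, fun j => ?_⟩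
    · simp only [hre]
      exact Submodule.zero_mem (S.harmonicForms _)
    · simp only [him, hn]
      exact Subtype.mem _
    have h1 := congrFun (H.aPeriods_dualForm (Sum.inr k)) (Sum.inl j)
    have h2 := congrFun (H.aPeriods_dualForm (Sum.inr k)) (Sum.inr j)
    rw [← neg_inj, ← Pi.neg_apply, ← map_neg, H.aPeriods_inl] at h1
    rw [← neg_inj, ← Pi.neg_apply, ← map_neg, H.aPeriods_inr] at h2
    have h0 : ∀ c : F × Fin 4 → ℤ, blackPairing c (fun _ : F => (0 : ℝ)) = 0 := fun c =>
      map_zero (blackPairing c)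
    have h0' : ∀ r : F → ℝ, r * (fun _ : F => (0 : ℝ)) = 0 := fun r => mul_zero r
    simp only [blackPeriod_ofForm, whitePeriod_ofForm, hre, him, h0, h0', map_zero, hn]
    constructor
    · rw [h2]
      by_cases hj : j = k <;> simp [hj]
    · rw [h1]
      simp

theorem omegaB_eq (hS : S.Orthodiagonal) (k : Fin g) :
    omegaB H k = S.ofForm (fun Q => (S.rho Q).re)
      (fun Q => ((H.dualForm (Sum.inl k)).1 Q : ℂ)) :=
  (isOmegaB_iff H hS k _).1 (Classical.epsilon_spec ⟨_, (isOmegaB_iff H hS k _).2 rfl⟩)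

theorem omegaW_eq (hS : S.Orthodiagonal) (k : Fin g) :
    omegaW H k = S.ofForm (fun Q => (S.rho Q).re)
      (fun Q => ((-(H.dualForm (Sum.inr k)).1 Q : ℝ) : ℂ) * Complex.I) :=
  (isOmegaW_iff H hS k _).1 (Classical.epsilon_spec ⟨_, (isOmegaW_iff H hS k _).2 rfl⟩)

/-! ### Periods for real and for imaginary `p` -/

theorem blackPeriod_ofForm_im (r : F → ℝ) {p : F → ℂ} (hp : ∀ Q, (p Q).im = 0)
    (P : List S.MedialDart) : (S.blackPeriod (S.ofForm r p) P).im = 0 := by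
  have h : (fun Q => (p Q).im) = 0 := funext hp
  rw [blackPeriod_ofForm, h, map_zero]
  simp

theorem blackPeriod_ofForm_re (r : F → ℝ) {p : F → ℂ} (hp : ∀ Q, (p Q).re = 0)
    (P : List S.MedialDart) : (S.blackPeriod (S.ofForm r p) P).re = 0 := by
  have h : (fun Q => (p Q).re) = 0 := funext hp
  rw [blackPeriod_ofForm, h, map_zero]
  simp

theorem whitePeriod_ofForm_re (r : F → ℝ) {p : F → ℂ} (hp : ∀ Q, (p Q).im = 0)
    (P : List S.MedialDart) : (S.whitePeriod (S.ofForm r p) P).re = 0 := by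
  have h : (fun Q => (p Q).im) = 0 := funext hp
  rw [whitePeriod_ofForm, h, mul_zero, map_zero]
  simp

theorem whitePeriod_ofForm_im (r : F → ℝ) {p : F → ℂ} (hp : ∀ Q, (p Q).re = 0)
    (P : List S.MedialDart) : (S.whitePeriod (S.ofForm r p) P).im = 0 := by
  have h : (fun Q => (p Q).re) = 0 := funext hp
  rw [whitePeriod_ofForm, h, mul_zero, map_zero]
  simp

end DiscreteRiemannSurface

/-- On an orthodiagonal discrete Riemann surface the canonical basis of discrete holomorphic
differentials is well defined, `Π^{W,B}` and `Π^{B,W}` are purely imaginary, and `Π^{B,B}` and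
`Π^{W,W}` are real. -/
theorem mainTheorem6 {F : Type*} [Fintype F] (S : DiscreteRiemannSurface F)
    (hS : S.Orthodiagonal) (g : ℕ) (H : S.CanonicalHomologyBasis g) :
    ((∀ k : Fin g, ∃! ω : S.Differential, DiscreteRiemannSurface.IsOmegaB H k ω) ∧
      (∀ k : Fin g, ∃! ω : S.Differential, DiscreteRiemannSurface.IsOmegaW H k ω)) ∧
    (∀ j k : Fin g, (DiscreteRiemannSurface.PiWB H j k).re = 0) ∧
    (∀ j k : Fin g, (DiscreteRiemannSurface.PiBW H j k).re = 0) ∧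
    (∀ j k : Fin g, (DiscreteRiemannSurface.PiBB H j k).im = 0) ∧
    (∀ j k : Fin g, (DiscreteRiemannSurface.PiWW H j k).im = 0) := by
  refine ⟨⟨fun k => ?_, fun k => ?_⟩, fun j k => ?_, fun j k => ?_, fun j k => ?_, fun j k => ?_⟩
  · exact ⟨_, (DiscreteRiemannSurface.isOmegaB_iff H hS k _).2 rfl, fun ω hω =>
      (DiscreteRiemannSurface.isOmegaB_iff H hS k ω).1 hω⟩
  · exact ⟨_, (DiscreteRiemannSurface.isOmegaW_iff H hS k _).2 rfl, fun ω hω =>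
      (DiscreteRiemannSurface.isOmegaW_iff H hS k ω).1 hω⟩
  · rw [DiscreteRiemannSurface.PiWB, Matrix.of_apply, DiscreteRiemannSurface.omegaB_eq H hS]
    exact DiscreteRiemannSurface.whitePeriod_ofForm_re _ (fun Q => by simp) _
  · rw [DiscreteRiemannSurface.PiBW, Matrix.of_apply, DiscreteRiemannSurface.omegaW_eq H hS]
    exact DiscreteRiemannSurface.blackPeriod_ofForm_re _ (fun Q => by simp) _
  · rw [DiscreteRiemannSurface.PiBB, Matrix.of_apply, DiscreteRiemannSurface.omegaB_eq H hS]
    exact DiscreteRiemannSurface.blackPeriod_ofForm_im _ (fun Q => by simp) _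
  · rw [DiscreteRiemannSurface.PiWW, Matrix.of_apply, DiscreteRiemannSurface.omegaW_eq H hS]
    exact DiscreteRiemannSurface.whitePeriod_ofForm_im _ (fun Q => by simp) _
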